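/- Let $n \ge k \ge 1$ be integers. A signed $k$-subset of $[n]=\{1,\dots,n\}$ is a $k$-element subset $A$ of $\{\pm1,\dots,\pm n\}$ containing at most one of $i,-i$ for each $i\in[n]$; write $-A=\{-a : a\in A\}$. The Kneser signed graph $\mathrm{KS}(n,k)$ has the signed $k$-subsets of $[n]$ as vertices; $A$ and $B$ are joined by a positive edge if $A\cap(-B)=\emptyset$, and by a negative edge if $A\cap B=\emptyset$ (they may be joined by both). The Schrijver signed graph $\mathrm{SS}(n,k)$ is its subgraph induced by the alternating signed $k$-subsets, that is, those of the form $\{a_1,-a_2,\dots,(-1)^{k-1}a_k\}$ or $\{-a_1,a_2,\dots,(-1)^k a_k\}$ with $1\le a_1<\dots<a_k\le n$. Let $\widehat{\mathrm{KS}}(n,k)$ and $\widehat{\mathrm{SS}}(n,k)$ be the subgraphs of $\mathrm{KS}(n,k)$ and $\mathrm{SS}(n,k)$ induced by the vertices whose element of least absolute value is positive. For a signed graph $(G,\sigma)$, let $(G,\sigma)^-$ be the graph with the same vertices whose edges are the negative edges of $(G,\sigma)$. Switching a vertex reverses the signs of all non-loop edges at it; write $\sigma'\equiv\sigma$ if $\sigma'$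 arises from $\sigma$ by a sequence of vertex switchings. A signed graph is balanced if it can be switched so that all its edges are positive, and the balanced chromatic number $\chi_b(G,\sigma)$ is the least positive integer $p$ such that the vertices can be coloured with $p$ colours so that each colour class induces a balanced signed graph. Then $$\chi\big(\widehat{\mathrm{KS}}(n,k)^-\big)=\chi\big(\widehat{\mathrm{SS}}(n,k)^-\big)=n-k+1.$$ Moreover, if $(G,\sigma)$ is either of $\widehat{\mathrm{KS}}(n,k)$ and $\widehat{\mathrm{SS}}(n,k)$ with its given signature, then $$\chi_b(G,\sigma)=\min_{\sigma'\equiv\sigma}\chi\big((G,\sigma')^-\big)=\chi\big((G,\sigma)^-\big),$$ so the given signature attains the minimum. -/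

import Mathlib

/-- A signed graph on the vertex set `V`: two vertices may be joined by a positive edge, by a negative
edge, or by both. `G.Adj s u v` says that `u` and `v` are joined by an edge of sign `s`.
Negative loops are not allowed; positive loops are. -/
@[ext] structure SignedGraph (V : Type*) where
  Adj : ℤˣ → V → V → Prop
  symm : ∀ s u v, Adj s u v → Adj s v u
  no_neg_loop : ∀ v, ¬ Adj (-1) v v

namespace SignedGraph

variable {V : Type*}

/-- The signed subgraph induced by a set of vertices. -/
def induce (G : SignedGraph V) (X : Set V) : SignedGraph X where
  Adj s u v := G.Adj s u v
  symm s u v h := G.symm s u v h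
  no_neg_loop v := G.no_neg_loop v

/-- The graph of negative edges, on the vertex set of `G`. -/
def negativeSubgraph (G : SignedGraph V) : SimpleGraph V where
  Adj u v := G.Adj (-1) u v
  symm := ⟨fun u v h => G.symm (-1) u v h⟩
  loopless := ⟨fun v h => G.no_neg_loop v h⟩

open Classical in
/-- The sign by which switching the vertex `w` multiplies the sign of an edge with ends `u` and `v`:
`-1` if exactly one of the ends is `w`, and `1` otherwise. -/
noncomputable def switchSign (w u v : V) : ℤˣ :=
  if (u = w ↔ v = w) then 1 else -1

theorem switchSign_comm (w u v : V) : switchSign w u v = switchSign w v u := by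
  unfold switchSign
  by_cases hu : u = w <;> by_cases hv : v = w <;> simp [hu, hv]

theorem switchSign_self (w v : V) : switchSign w v v = 1 := by
  simp [switchSign]

/-- Switching a vertex `w`: the sign of every non-loop edge at `w` is reversed. -/
noncomputable def switch (G : SignedGraph V) (w : V) : SignedGraph V where
  Adj s u v := G.Adj (switchSign w u v * s) u v
  symm s u v h := by
    rw [switchSign_comm]
    exact G.symm _ u v h
  no_neg_loop v := by
    rw [switchSign_self, one_mul]
    exact G.no_neg_loop v

/-- `H` is obtained from `G` by a sequence of vertex switchings. -/
def SwitchingEquivalent (G H : SignedGraph V) : Prop :=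
  Relation.ReflTransGen (fun G₁ G₂ => ∃ w, G₂ = G₁.switch w) G H

/-- A signed graph is balanced if it can be switched to one all of whose edges are positive. -/
def IsBalanced (G : SignedGraph V) : Prop :=
  ∃ H : SignedGraph V, G.SwitchingEquivalent H ∧ ∀ u v, ¬ H.Adj (-1) u v

/-- `f` is a balanced `p`-colouring: every colour class induces a balanced signed graph. -/
def IsBalancedColouring (G : SignedGraph V) {p : ℕ} (f : V → Fin p) : Prop :=
  ∀ i : Fin p, (G.induce (f ⁻¹' {i})).IsBalanced

/-- The balanced chromatic number: the least positive `p` for which there is a balanced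
`p`-colouring (`⊤` if there is none). -/
noncomputable def balancedChromaticNumber (G : SignedGraph V) : ℕ∞ :=
  ⨅ p ∈ {p : ℕ | 0 < p ∧ ∃ f : V → Fin p, G.IsBalancedColouring f}, (p : ℕ∞)

end SignedGraph

open scoped Pointwise

/-- Signed `k`-subsets of `[n]`: the `k`-subsets of `{±1, …, ±n}` that contain at most one of
`i` and `-i` for each `i`. -/
def IsSignedSubset (n k : ℕ) (A : Finset ℤ) : Prop :=
  (∀ a ∈ A, a ≠ 0 ∧ |a| ≤ (n : ℤ)) ∧ A.card = k ∧
    ∀ i ∈ Finset.Icc (1 : ℤ) n, (A ∩ {i, -i}).card ≤ 1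

/-- The type of signed `k`-subsets of `[n]`. -/
abbrev SignedSubset (n k : ℕ) : Type := {A : Finset ℤ // IsSignedSubset n k A}

/-- The Kneser signed graph: `A` and `B` are joined by a positive edge if `A ∩ (-B) = ∅` and by a
negative edge if `A ∩ B = ∅`. The hypothesis `1 ≤ k` excludes negative loops. -/
def kneserSignedGraph (n k : ℕ) (hk : 1 ≤ k) : SignedGraph (SignedSubset n k) where
  Adj s A B := (s = 1 ∧ A.1 ∩ (-B.1) = ∅) ∨ (s = -1 ∧ A.1 ∩ B.1 = ∅)
  symm s A B h := by
    rcases h with ⟨hs, h⟩ | ⟨hs, h⟩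
    · refine Or.inl ⟨hs, ?_⟩
      rw [← Finset.disjoint_iff_inter_eq_empty, Finset.disjoint_left] at h ⊢
      intro b hb hbA
      rw [Finset.mem_neg'] at hbA
      exact h hbA (by rw [Finset.mem_neg', neg_neg]; exact hb)
    · exact Or.inr ⟨hs, by rw [Finset.inter_comm]; exact h⟩
  no_neg_loop A h := by
    rcases h with ⟨hs, -⟩ | ⟨-, h⟩
    · exact absurd hs (by decide)
    · rw [Finset.inter_self] at h
      have hc := A.2.2.1
      rw [h, Finset.card_empty] at hc
      omega

/-- `A` has the form `{a₁, -a₂, …, (-1)^(k-1) a_k}` or `{-a₁, a₂, …, (-1)^k a_k}` with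
`1 ≤ a₁ < a₂ < ⋯ < a_k ≤ n`. -/
def IsAlternating (n k : ℕ) (A : Finset ℤ) : Prop :=
  ∃ a : Fin k → ℤ, StrictMono a ∧ (∀ j, 1 ≤ a j ∧ a j ≤ (n : ℤ)) ∧
    (A = Finset.univ.image (fun j : Fin k => (-1) ^ (j : ℕ) * a j) ∨
      A = Finset.univ.image (fun j : Fin k => (-1) ^ ((j : ℕ) + 1) * a j))

/-- The Schrijver signed graph: the subgraph of the Kneser signed graph induced by the
alternating signed `k`-subsets. -/
def schrijverSignedGraph (n k : ℕ) (hk : 1 ≤ k) :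
    SignedGraph {A : SignedSubset n k | IsAlternating n k A.1} :=
  (kneserSignedGraph n k hk).induce _

/-- The element of `A` of least absolute value is positive: the first nonzero coordinate of the
`{-1, 0, 1}`-vector of `A` is positive. -/
def FirstPositive (A : Finset ℤ) : Prop :=
  ∃ a ∈ A, 0 < a ∧ ∀ b ∈ A, |a| ≤ |b|

/-- The subgraph of the Kneser signed graph induced by the vertices whose first nonzero coordinate
is positive. -/
def kneserSignedGraphHat (n k : ℕ) (hk : 1 ≤ k) :
    SignedGraph {A : SignedSubset n k | FirstPositive A.1} :=
  (kneserSignedGraph n k hk).induce _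

/-- The subgraph of the Schrijver signed graph induced by the vertices whose first nonzero
coordinate is positive. -/
def schrijverSignedGraphHat (n k : ℕ) (hk : 1 ≤ k) :
    SignedGraph {A : {A : SignedSubset n k | IsAlternating n k A.1} | FirstPositive A.1.1} :=
  (schrijverSignedGraph n k hk).induce _

/-! Upper bound: colour a vertex by its element of least absolute value, a positive integer `a`. All
`k` absolute values lie in `[a, n]`, so `a ≤ n - k + 1`, and two vertices sharing an element have no
negative edge between them.

Lower bound: it suffices to prove `n - k + 1 ≤ χ_b`, since a proper colouring of the negative edges
of any switching is a balanced colouring. A balanced `p`-colouring provides vertex signs `ε` with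
every edge `uv` inside a class of sign `ε u * ε v`. Label signed sets `X` by the sizes `< k` of
alternating subsets of `X`, signed by their first element, and by `k +` the colour of each vertex
lying in `X` up to sign, the sign being twisted by `ε`. Opposite labels of the same size give a
longer alternating subset; opposite labels of the same colour give an edge of the wrong sign. So
`octahedral_tucker` applies and yields `n ≤ k + p - 1`. Only alternating vertices are needed, which
covers both graphs.

The Tucker lemma is a mod 2 count: among chains ending at full signed sets containing `n`, an odd
number alternate in sign at every step. Each sign change raises the largest label, so some label is
at least `n`. -/

/-! ### Mod 2 counts of sign-alternating chains -/

section ChainCount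

variable {α : Type*} [DecidableEq α]

/-- Two elements can be removed in either order, so terms cancel in pairs: `∂∂ = 0` mod 2. -/
theorem sum_sum_erase_erase_eq_zero (g : Finset α → ZMod 2) (X : Finset α) :
    ∑ a ∈ X, ∑ b ∈ X.erase a, g ((X.erase a).erase b) = 0 := by
  rw [Finset.sum_sigma']
  refine Finset.sum_involution (fun x _ => ⟨x.2, x.1⟩) ?_ ?_ ?_ ?_
  · rintro ⟨a, b⟩ _
    simp only
    rw [Finset.erase_right_comm]
    exact CharTwo.add_self_eq_zero _
  · rintro ⟨a, b⟩ h _ he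
    simp only [Finset.mem_sigma, Finset.mem_erase] at h
    simp only [Sigma.mk.injEq] at he
    exact h.2.1 he.1
  · rintro ⟨a, b⟩ h
    simp only [Finset.mem_sigma, Finset.mem_erase] at h ⊢
    exact ⟨h.2.2, fun e => h.2.1 e.symm, h.1⟩
  · rintro ⟨a, b⟩ _
    rfl

/-- For `X` of cardinality `j + 1`: the parity of the number of saturated chains of nonempty sets
with top `X` along which the sign `s` alternates. -/
def alternatingChainCount (s : Finset α → ZMod 2) : ℕ → Finset α → ZMod 2
  | 0, _ => 1
  | j + 1, X => ∑ a ∈ X, (s X + s (X.erase a)) * alternatingChainCount s j (X.erase a)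

variable (s : Finset α → ZMod 2)

theorem alternatingChainCount_succ_eq (j : ℕ) (X : Finset α)
    (h : ∑ a ∈ X, alternatingChainCount s j (X.erase a) = 0) :
    alternatingChainCount s (j + 1) X =
      ∑ a ∈ X, s (X.erase a) * alternatingChainCount s j (X.erase a) := by
  simp only [alternatingChainCount, add_mul, Finset.sum_add_distrib]
  rw [← Finset.mul_sum, h, mul_zero, zero_add]

/-- The summand `s X` factors out of the recursion and multiplies the same sum one dimension lower,
which is zero by induction. What remains is a double boundary. -/
theorem sum_alternatingChainCount_erase (j : ℕ) (X : Finset α) (hX : X.card = j + 2) :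
    ∑ a ∈ X, alternatingChainCount s j (X.erase a) = 0 := by
  induction j generalizing X with
  | zero =>
    simp only [alternatingChainCount, Finset.sum_const, hX]
    decide
  | succ j ih =>
    rw [← sum_sum_erase_erase_eq_zero (fun Y => s Y * alternatingChainCount s j Y) X]
    refine Finset.sum_congr rfl fun a ha => ?_
    refine alternatingChainCount_succ_eq s j _ (ih _ ?_)
    rw [Finset.card_erase_of_mem ha, hX]
    rfl

/-- A nonzero count supplies an alternating chain below `X`, and `L` rises strictly at each of its
steps. -/
theorem card_le_of_alternatingChainCount_ne_zero (L : Finset α → ℕ) (X₀ : Finset α)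
    (hL : ∀ Y ⊆ X₀, Y.Nonempty → 1 ≤ L Y)
    (hlt : ∀ Y X, Y ⊆ X → X ⊆ X₀ → Y.Nonempty → s X ≠ s Y → L Y < L X) (j : ℕ) (X : Finset α)
    (hX₀ : X ⊆ X₀) (hX : X.card = j + 1) (h : alternatingChainCount s j X ≠ 0) : j + 1 ≤ L X := by
  induction j generalizing X with
  | zero => exact hL X hX₀ (Finset.card_pos.mp (by omega))
  | succ j ih =>
    obtain ⟨a, ha, hne⟩ := Finset.exists_ne_zero_of_sum_ne_zero h
    have hcard : (X.erase a).card = j + 1 := by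
      rw [Finset.card_erase_of_mem ha, hX]
      rfl
    have hsub := Finset.erase_subset a X
    have h1 := ih _ (hsub.trans hX₀) hcard (right_ne_zero_of_mul hne)
    have h2 : s X ≠ s (X.erase a) := fun e => by
      rw [e, CharTwo.add_self_eq_zero, zero_mul] at hne
      exact hne rfl
    have h3 := hlt _ X hsub hX₀ (Finset.card_pos.mp (by omega)) h2
    omega

end ChainCount

/-! ### Signed sets and full signed sets -/

/-- `X` is a set of nonzero integers of absolute value at most `n` without opposite elements. -/
def IsSignedSet (n : ℕ) (X : Finset ℤ) : Prop :=
  ∀ a ∈ X, a ≠ 0 ∧ |a| ≤ (n : ℤ) ∧ -a ∉ X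

theorem IsSignedSet.mono {n : ℕ} {X Y : Finset ℤ} (h : IsSignedSet n X) (hYX : Y ⊆ X) :
    IsSignedSet n Y :=
  fun a ha => ⟨(h a (hYX ha)).1, (h a (hYX ha)).2.1, fun h' => (h a (hYX ha)).2.2 (hYX h')⟩

/-- `X` contains exactly one of `i` and `-i` for each `i` in `[j]`, and no other integers. -/
def IsFullSignedSet (j : ℕ) (X : Finset ℤ) : Prop :=
  ∀ i, i ∈ X ↔ i ≠ 0 ∧ |i| ≤ (j : ℤ) ∧ -i ∉ X

open Classical in
/-- The finite set of all full signed subsets of `[j]`. -/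
noncomputable def fullSignedSets (j : ℕ) : Finset (Finset ℤ) :=
  (Finset.Icc (-(j : ℤ)) j).powerset.filter (IsFullSignedSet j)

theorem mem_fullSignedSets {j : ℕ} {X : Finset ℤ} :
    X ∈ fullSignedSets j ↔ IsFullSignedSet j X := by
  simp only [fullSignedSets, Finset.mem_filter, Finset.mem_powerset, and_iff_right_iff_imp]
  intro h i hi
  exact Finset.mem_Icc.mpr (abs_le.mp ((h i).mp hi).2.1)

namespace IsFullSignedSet

variable {j : ℕ} {X : Finset ℤ}

theorem isSignedSet (h : IsFullSignedSet j X) {n : ℕ} (hjn : j ≤ n) : IsSignedSet n X := by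
  intro a ha
  obtain ⟨h1, h2, h3⟩ := (h a).mp ha
  exact ⟨h1, by omega, h3⟩

theorem neg (h : IsFullSignedSet j X) : IsFullSignedSet j (-X) := by
  intro i
  have := h i
  have := h (-i)
  rw [Finset.mem_neg', Finset.mem_neg']
  rw [abs_neg, neg_neg] at this
  grind

theorem card_eq (h : IsFullSignedSet j X) : X.card = j := by
  have hinj : Set.InjOn Int.natAbs (X : Set ℤ) := by
    intro a ha b hb hab
    rcases Int.natAbs_eq_natAbs_iff.mp hab with e | e
    · exact e
    · exact absurd (by rw [e, neg_neg]; exact hb) ((h a).mp ha).2.2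
  have himg : X.image Int.natAbs = Finset.Icc 1 j := by
    ext m
    rw [Finset.mem_image, Finset.mem_Icc]
    constructor
    · rintro ⟨a, ha, rfl⟩
      have := (h a).mp ha
      rw [Int.abs_eq_natAbs] at this
      omega
    · rintro ⟨h1, h2⟩
      by_cases hm : (m : ℤ) ∈ X
      · exact ⟨m, hm, Int.natAbs_natCast m⟩
      · refine ⟨-m, ?_, by simp⟩
        rw [h]
        refine ⟨by omega, ?_, by rwa [neg_neg]⟩
        rw [abs_neg, abs_of_nonneg (by omega)]
        omega
  rw [← Finset.card_image_of_injOn hinj, himg, Nat.card_Icc]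
  rfl

theorem insert_neg_erase (h : IsFullSignedSet j X) {a : ℤ} (ha : a ∈ X) :
    IsFullSignedSet j (insert (-a) (X.erase a)) := by
  intro i
  have h1 := h i
  have h2 := (h a).mp ha
  simp only [Finset.mem_insert, Finset.mem_erase]
  by_cases hi : i = a
  · subst hi
    simp
    omega
  · by_cases hi' : i = -a
    · subst hi'
      simp
      rw [abs_neg] at h1
      omega
    · have : -i ≠ -a := fun e => hi (neg_injective e)
      have : -i ≠ a := fun e => hi' (by rw [← e, neg_neg])
      simp_all

theorem erase_top (h : IsFullSignedSet (j + 1) X) (hX : ((j + 1 : ℕ) : ℤ) ∈ X) :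
    IsFullSignedSet j (X.erase ((j + 1 : ℕ) : ℤ)) := by
  intro i
  have h1 := h i
  have h2 := ((h _).mp hX).2.2
  simp only [Finset.mem_erase]
  grind

theorem insert_top (h : IsFullSignedSet j X) :
    IsFullSignedSet (j + 1) (insert ((j + 1 : ℕ) : ℤ) X) := by
  intro i
  have h1 := h i
  have h2 := h (j + 1 : ℕ)
  have h3 := h (-(j + 1 : ℕ))
  simp only [Finset.mem_insert]
  grind

theorem top_notMem (h : IsFullSignedSet j X) : ((j + 1 : ℕ) : ℤ) ∉ X := by
  intro h'
  have := (h _).mp h'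
  grind

theorem top_mem_or (h : IsFullSignedSet (j + 1) X) :
    ((j + 1 : ℕ) : ℤ) ∉ X ↔ -((j + 1 : ℕ) : ℤ) ∈ X := by
  have := h (-((j + 1 : ℕ) : ℤ))
  rw [neg_neg] at this
  grind

end IsFullSignedSet

/-! ### Antipodal signs force an odd number of alternating chains -/

section Parity

variable {n : ℕ} {s : Finset ℤ → ZMod 2}

theorem neg_erase_neg (X : Finset ℤ) (a : ℤ) : (-X).erase (-a) = -(X.erase a) := by
  ext i
  simp only [Finset.mem_erase, Finset.mem_neg']
  grind

/-- Negation adds `1` to both signs in each factor, which changes nothing mod 2. -/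
theorem alternatingChainCount_neg
    (hs : ∀ X, IsSignedSet n X → X.Nonempty → s (-X) = s X + 1) (j : ℕ) (X : Finset ℤ)
    (hX : IsSignedSet n X) (hcard : X.card = j + 1) :
    alternatingChainCount s j (-X) = alternatingChainCount s j X := by
  induction j generalizing X with
  | zero => rfl
  | succ j ih =>
    simp only [alternatingChainCount]
    refine (Finset.sum_bij (fun a _ => -a) (fun a ha => Finset.neg_mem_neg ha)
      (fun a _ b _ h => neg_injective h)
      (fun b hb => ⟨-b, Finset.mem_neg'.mp hb, neg_neg b⟩) ?_).symm
    intro a ha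
    have hc : (X.erase a).card = j + 1 := by
      rw [Finset.card_erase_of_mem ha, hcard]
      rfl
    have hsg := hX.mono (Finset.erase_subset a X)
    rw [neg_erase_neg, ih _ hsg hc, hs _ hX (Finset.card_pos.mp (by omega)),
      hs _ hsg (Finset.card_pos.mp (by omega))]
    have h2 : (1 : ZMod 2) + 1 = 0 := by decide
    linear_combination (-alternatingChainCount s j (X.erase a)) * h2

/-- A facet that omits `±a` with `a` not the top element lies in exactly two of the full sets, so it
cancels; only the facets omitting the top survive. -/
theorem sum_fullSignedSets_top_succ (h : Finset ℤ → ZMod 2) (j : ℕ) :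
    ∑ X ∈ (fullSignedSets (j + 1)).filter (((j + 1 : ℕ) : ℤ) ∈ ·), ∑ a ∈ X, h (X.erase a) =
      ∑ Y ∈ fullSignedSets j, h Y := by
  set t : ℤ := ((j + 1 : ℕ) : ℤ) with ht
  have hsplit : ∀ X ∈ (fullSignedSets (j + 1)).filter (t ∈ ·),
      ∑ a ∈ X, h (X.erase a) = h (X.erase t) + ∑ a ∈ X.erase t, h (X.erase a) := by
    intro X hX
    exact (Finset.add_sum_erase X (fun a => h (X.erase a)) (Finset.mem_filter.mp hX).2).symm
  rw [Finset.sum_congr rfl hsplit, Finset.sum_add_distrib]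
  have hzero : ∑ X ∈ (fullSignedSets (j + 1)).filter (t ∈ ·),
      ∑ a ∈ X.erase t, h (X.erase a) = 0 := by
    rw [Finset.sum_sigma']
    -- The involution flips the sign of the omitted element.
    refine Finset.sum_involution (fun x _ => ⟨insert (-x.2) (x.1.erase x.2), -x.2⟩) ?_ ?_ ?_ ?_
    · rintro ⟨X, a⟩ hx
      simp only [Finset.mem_sigma, Finset.mem_filter, mem_fullSignedSets, Finset.mem_erase] at hx
      have hna : -a ∉ X.erase a := fun h' =>
        ((hx.1.1 a).mp hx.2.2).2.2 (Finset.mem_of_mem_erase h')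
      simp only
      rw [Finset.erase_insert hna]
      exact CharTwo.add_self_eq_zero _
    · rintro ⟨X, a⟩ hx _ he
      simp only [Finset.mem_sigma, Finset.mem_filter, mem_fullSignedSets, Finset.mem_erase] at hx
      simp only [Sigma.mk.injEq, heq_eq_eq] at he
      have := ((hx.1.1 a).mp hx.2.2).1
      omega
    · rintro ⟨X, a⟩ hx
      simp only [Finset.mem_sigma, Finset.mem_filter, mem_fullSignedSets, Finset.mem_erase] at hx ⊢
      refine ⟨⟨hx.1.1.insert_neg_erase hx.2.2, ?_⟩, ?_, Finset.mem_insert_self _ _⟩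
      · exact Finset.mem_insert_of_mem (Finset.mem_erase.mpr ⟨fun e => hx.2.1 e.symm, hx.1.2⟩)
      · intro e
        exact ((hx.1.1 a).mp hx.2.2).2.2 (e ▸ hx.1.2)
    · rintro ⟨X, a⟩ hx
      simp only [Finset.mem_sigma, Finset.mem_filter, mem_fullSignedSets, Finset.mem_erase] at hx
      have hna : -a ∉ X.erase a := fun h' =>
        ((hx.1.1 a).mp hx.2.2).2.2 (Finset.mem_of_mem_erase h')
      simp only [neg_neg, Finset.erase_insert hna, Finset.insert_erase hx.2.2]
  rw [hzero, add_zero]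
  refine Finset.sum_bij' (fun X _ => X.erase t) (fun Y _ => insert t Y) ?_ ?_ ?_ ?_ ?_
  · intro X hX
    rw [Finset.mem_filter, mem_fullSignedSets] at hX
    exact mem_fullSignedSets.mpr (hX.1.erase_top hX.2)
  · intro Y hY
    rw [Finset.mem_filter, mem_fullSignedSets]
    exact ⟨(mem_fullSignedSets.mp hY).insert_top, Finset.mem_insert_self _ _⟩
  · intro X hX
    exact Finset.insert_erase (Finset.mem_filter.mp hX).2
  · intro Y hY
    exact Finset.erase_insert (mem_fullSignedSets.mp hY).top_notMem
  · intro X _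
    rfl

theorem sum_fullSignedSets_eq_sum_add_neg (h : Finset ℤ → ZMod 2) (j : ℕ) :
    ∑ Y ∈ fullSignedSets (j + 1), h Y =
      ∑ Y ∈ (fullSignedSets (j + 1)).filter (((j + 1 : ℕ) : ℤ) ∈ ·), (h Y + h (-Y)) := by
  rw [← Finset.sum_filter_add_sum_filter_not _ (((j + 1 : ℕ) : ℤ) ∈ ·), Finset.sum_add_distrib]
  congr 1
  have key : ∀ Y, IsFullSignedSet (j + 1) Y → IsFullSignedSet (j + 1) (-Y) := fun Y hY => hY.neg
  refine Finset.sum_bij' (fun X _ => -X) (fun Y _ => -Y) ?_ ?_ ?_ ?_ ?_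
  · intro X hX
    rw [Finset.mem_filter, mem_fullSignedSets] at hX ⊢
    exact ⟨key X hX.1, Finset.mem_neg'.mpr (hX.1.top_mem_or.mp hX.2)⟩
  · intro X hX
    rw [Finset.mem_filter, mem_fullSignedSets] at hX ⊢
    refine ⟨key X hX.1, (key X hX.1).top_mem_or.mpr ?_⟩
    rw [Finset.mem_neg', neg_neg]
    exact hX.2
  · intro X _
    exact neg_neg X
  · intro X _
    exact neg_neg X
  · intro X _
    simp only [neg_neg]

theorem fullSignedSets_one_filter :
    (fullSignedSets 1).filter (((0 + 1 : ℕ) : ℤ) ∈ ·) = {{1}} := by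
  ext X
  rw [Finset.mem_filter, mem_fullSignedSets, Finset.mem_singleton]
  constructor
  · rintro ⟨h, h1⟩
    obtain ⟨a, ha⟩ := Finset.card_eq_one.mp h.card_eq
    rw [ha, Finset.mem_singleton] at h1
    rw [ha, ← h1]
    rfl
  · rintro rfl
    refine ⟨fun i => ?_, by simp⟩
    simp only [Finset.mem_singleton]
    grind

/-- Passing to facets leaves the sum of `s Y * count Y` over all full `Y` one dimension lower.
Pairing `Y` with `-Y` replaces the weight by `s Y + s (-Y) = 1`, which is the previous sum. -/
theorem sum_alternatingChainCount_eq_one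
    (hs : ∀ X, IsSignedSet n X → X.Nonempty → s (-X) = s X + 1) (j : ℕ) (hj : j + 1 ≤ n) :
    ∑ X ∈ (fullSignedSets (j + 1)).filter (((j + 1 : ℕ) : ℤ) ∈ ·),
      alternatingChainCount s j X = 1 := by
  induction j with
  | zero =>
    rw [fullSignedSets_one_filter]
    rfl
  | succ j ih =>
    rw [← ih (by omega)]
    have h1 : ∀ X ∈ (fullSignedSets (j + 1 + 1)).filter (((j + 1 + 1 : ℕ) : ℤ) ∈ ·),
        alternatingChainCount s (j + 1) X =
          ∑ a ∈ X, s (X.erase a) * alternatingChainCount s j (X.erase a) := by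
      intro X hX
      rw [Finset.mem_filter, mem_fullSignedSets] at hX
      exact alternatingChainCount_succ_eq s j X
        (sum_alternatingChainCount_erase s j X hX.1.card_eq)
    rw [Finset.sum_congr rfl h1,
      sum_fullSignedSets_top_succ (fun Y => s Y * alternatingChainCount s j Y),
      sum_fullSignedSets_eq_sum_add_neg]
    refine Finset.sum_congr rfl fun Y hY => ?_
    rw [Finset.mem_filter, mem_fullSignedSets] at hY
    have hsg := hY.1.isSignedSet (n := n) (by omega)
    rw [alternatingChainCount_neg hs j Y hsg hY.1.card_eq, hs Y hsg ⟨_, hY.2⟩]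
    have h2 : s Y + s Y = 0 := CharTwo.add_self_eq_zero _
    linear_combination (alternatingChainCount s j Y) * h2

theorem exists_alternatingChainCount_ne_zero (hn : 1 ≤ n)
    (hs : ∀ X, IsSignedSet n X → X.Nonempty → s (-X) = s X + 1) :
    ∃ X, IsFullSignedSet n X ∧ alternatingChainCount s (n - 1) X ≠ 0 := by
  obtain ⟨j, rfl⟩ : ∃ j, n = j + 1 := ⟨n - 1, by omega⟩
  have h := sum_alternatingChainCount_eq_one hs j le_rfl
  obtain ⟨X, hX, hne⟩ := Finset.exists_ne_zero_of_sum_ne_zero (by rw [h]; exact one_ne_zero)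
  exact ⟨X, mem_fullSignedSets.mp (Finset.mem_filter.mp hX).1, hne⟩

end Parity

/-- The octahedral Tucker lemma, for a relation `Q X l e` ("`X` admits the label `e * l`"): the label
of `X` is its label of largest absolute value. -/
theorem octahedral_tucker {n M : ℕ} (hn : 1 ≤ n) (Q : Finset ℤ → ℕ → ℤˣ → Prop)
    (hmono : ∀ X Y l e, X ⊆ Y → Q X l e → Q Y l e)
    (hneg : ∀ X l e, Q X l e → Q (-X) l (-e))
    (hbdd : ∀ X l e, Q X l e → l ≤ M)
    (hex : ∀ X, IsSignedSet n X → X.Nonempty → ∃ l e, 1 ≤ l ∧ Q X l e)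
    (hcon : ∀ X l, IsSignedSet n X → Q X l 1 → Q X l (-1) → ∃ l' e, l < l' ∧ Q X l' e) :
    n ≤ M := by
  classical
  let L : Finset ℤ → ℕ := fun X => Nat.findGreatest (fun l => ∃ e, Q X l e) M
  have hle : ∀ X l e, Q X l e → l ≤ L X := fun X l e h =>
    Nat.le_findGreatest (hbdd X l e h) ⟨e, h⟩
  have hspec : ∀ X, IsSignedSet n X → X.Nonempty → ∃ e, Q X (L X) e := by
    intro X hX hne
    obtain ⟨l, e, -, h⟩ := hex X hX hne
    exact Nat.findGreatest_spec (P := fun l => ∃ e, Q X l e) (hbdd X l e h) ⟨e, h⟩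
  have hnot : ∀ X, IsSignedSet n X → ¬ (Q X (L X) 1 ∧ Q X (L X) (-1)) := by
    rintro X hX ⟨h1, h2⟩
    obtain ⟨l', e, hlt, h⟩ := hcon X (L X) hX h1 h2
    exact absurd (hle X l' e h) (by omega)
  have hiff : ∀ X, IsSignedSet n X → X.Nonempty → (Q X (L X) (-1) ↔ ¬ Q X (L X) 1) := by
    intro X hX hne
    have h1 := hnot X hX
    obtain ⟨e, he⟩ := hspec X hX hne
    rcases Int.units_eq_one_or e with rfl | rfl <;> tauto
  have hnegiff : ∀ X l e, Q (-X) l e ↔ Q X l (-e) := by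
    intro X l e
    constructor
    · intro h
      simpa using hneg _ _ _ h
    · intro h
      simpa using hneg _ _ _ h
  have hLneg : ∀ X, L (-X) = L X := by
    intro X
    have hP : (fun l => ∃ e, Q (-X) l e) = fun l => ∃ e, Q X l e := by
      funext l
      refine propext ⟨fun ⟨e, h⟩ => ⟨-e, (hnegiff X l e).mp h⟩, fun ⟨e, h⟩ => ⟨-e, ?_⟩⟩
      rw [hnegiff, neg_neg]
      exact h
    simp only [L, hP]
  -- By `hcon` the largest label of a nonempty signed set carries only one sign; `s` records it.
  let s : Finset ℤ → ZMod 2 := fun X => if Q X (L X) 1 then 1 else 0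
  have hs : ∀ X, IsSignedSet n X → X.Nonempty → s (-X) = s X + 1 := by
    intro X hX hne
    have h1 : Q (-X) (L (-X)) 1 ↔ ¬ Q X (L X) 1 := by
      rw [hLneg, hnegiff, hiff X hX hne]
    by_cases h : Q X (L X) 1
    · simp only [s, h1, h]
      decide
    · simp only [s, h1, h]
      decide
  obtain ⟨X, hX, hne⟩ := exists_alternatingChainCount_ne_zero hn hs
  have hXs := hX.isSignedSet (n := n) le_rfl
  have hfin := card_le_of_alternatingChainCount_ne_zero s L X ?_ ?_ (n - 1) X subset_rfl
    (by rw [hX.card_eq]; omega) hne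
  · have : L X ≤ M := Nat.findGreatest_le M
    omega
  · intro Y hY hYne
    obtain ⟨l, e, hl, h⟩ := hex Y (hXs.mono hY) hYne
    exact hl.trans (hle Y l e h)
  · intro Y Z hYZ hZX hYne hsne
    have hZs := hXs.mono hZX
    have hYs := hZs.mono hYZ
    obtain ⟨e, he⟩ := hspec Y hYs hYne
    have heZ := hmono Y Z _ _ hYZ he
    -- If the largest labels agreed in size, `Z` would inherit the sign of `Y` by monotonicity.
    refine lt_of_le_of_ne (hle Z _ e heZ) fun hL => hsne ?_
    have h1 := hiff Y hYs hYne
    have h2 := hiff Z hZs (hYne.mono hYZ)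
    have h3 : Q Z (L Z) 1 ↔ Q Y (L Y) 1 := by
      rw [hL] at heZ
      rcases Int.units_eq_one_or e with rfl | rfl <;> tauto
    simp only [s, h3]

/-! ### Switching, vertex signs and balanced colourings -/

namespace SignedGraph

variable {V : Type*} {G H : SignedGraph V}

open Classical in
theorem switchSign_eq_mul (w u v : V) :
    switchSign w u v = (if u = w then -1 else 1) * (if v = w then -1 else 1) := by
  unfold switchSign
  by_cases hu : u = w <;> by_cases hv : v = w <;> simp [hu, hv]

/-- `ε v` is the parity of the number of switchings at `v`; at a loop it enters squared. -/
theorem SwitchingEquivalent.exists_sign (h : G.SwitchingEquivalent H) :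
    ∃ ε : V → ℤˣ, ∀ s u v, H.Adj s u v ↔ G.Adj (ε u * ε v * s) u v := by
  classical
  induction h with
  | refl => exact ⟨fun _ => 1, fun s u v => by simp⟩
  | tail _ h ih =>
    obtain ⟨ε, hε⟩ := ih
    obtain ⟨w, rfl⟩ := h
    refine ⟨fun u => ε u * (if u = w then -1 else 1), fun s u v => ?_⟩
    simp only [switch]
    rw [hε, switchSign_eq_mul]
    simp only [mul_assoc, mul_left_comm, mul_comm]

theorem switch_induce_of_notMem {X : Set V} {w : V} (hw : w ∉ X) :
    (G.switch w).induce X = G.induce X := by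
  ext s u v
  have hu : (u : V) ≠ w := fun h => hw (h ▸ u.2)
  have hv : (v : V) ≠ w := fun h => hw (h ▸ v.2)
  simp [induce, switch, switchSign, hu, hv]

theorem switch_induce_of_mem {X : Set V} {w : V} (hw : w ∈ X) :
    (G.switch w).induce X = (G.induce X).switch ⟨w, hw⟩ := by
  ext s u v
  have h1 : (u : V) = w ↔ u = ⟨w, hw⟩ := (Subtype.ext_iff (a2 := ⟨w, hw⟩)).symm
  have h2 : (v : V) = w ↔ v = ⟨w, hw⟩ := (Subtype.ext_iff (a2 := ⟨w, hw⟩)).symm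
  have h : switchSign w (u : V) v = switchSign (⟨w, hw⟩ : X) u v := by
    unfold switchSign
    by_cases hu : u = ⟨w, hw⟩ <;> by_cases hv : v = ⟨w, hw⟩ <;> simp [h1, h2, hu, hv]
  simp only [induce, switch, h]

theorem SwitchingEquivalent.induce (h : G.SwitchingEquivalent H) (X : Set V) :
    (G.induce X).SwitchingEquivalent (H.induce X) := by
  induction h with
  | refl => exact Relation.ReflTransGen.refl
  | tail _ h ih =>
    obtain ⟨w, rfl⟩ := h
    by_cases hw : w ∈ X
    · exact ih.tail ⟨⟨w, hw⟩, switch_induce_of_mem hw⟩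
    · rw [switch_induce_of_notMem hw]
      exact ih

/-- The switching restricts to each colour class, where no negative edge is left. -/
theorem SwitchingEquivalent.isBalancedColouring (h : G.SwitchingEquivalent H) {p : ℕ}
    (C : H.negativeSubgraph.Coloring (Fin p)) : G.IsBalancedColouring C := by
  intro i
  refine ⟨_, h.induce _, fun u v huv => C.valid (v := u.1) (w := v.1) huv ?_⟩
  exact u.2.trans v.2.symm

/-- A signature of a vertex set partitioned into balanced classes can be read off from vertex
signs. -/
theorem IsBalancedColouring.exists_sign {p : ℕ} {f : V → Fin p} (hf : G.IsBalancedColouring f) :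
    ∃ ε : V → ℤˣ, ∀ s u v, f u = f v → G.Adj s u v → s = ε u * ε v := by
  have hcls : ∀ i, ∃ ε : f ⁻¹' {i} → ℤˣ, ∀ s u v, G.Adj s u.1 v.1 → s = ε u * ε v := by
    intro i
    obtain ⟨H, hGH, hH⟩ := hf i
    obtain ⟨ε, hε⟩ := hGH.exists_sign
    refine ⟨ε, fun s u v huv => ?_⟩
    by_contra hne
    -- An edge whose sign differs from `ε u * ε v` would be negative after switching.
    refine hH u v ((hε _ u v).mpr ?_)
    have : ε u * ε v * -1 = s := by
      rw [mul_neg_one, eq_comm]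
      exact (Int.units_ne_iff_eq_neg).mp hne
    rw [this]
    exact huv
  choose ε hε using hcls
  have hcongr : ∀ i v (hv : f v = i), ε i ⟨v, hv⟩ = ε (f v) ⟨v, rfl⟩ := by
    rintro i v rfl
    rfl
  refine ⟨fun v => ε (f v) ⟨v, rfl⟩, fun s u v huv hadj => ?_⟩
  have := hε (f u) s ⟨u, rfl⟩ ⟨v, huv.symm⟩ hadj
  rwa [hcongr (f u) v huv.symm] at this

theorem balancedChromaticNumber_le_of_switchingEquivalent [Nonempty V]
    (h : G.SwitchingEquivalent H) :
    G.balancedChromaticNumber ≤ H.negativeSubgraph.chromaticNumber := by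
  refine le_iInf₂ fun p hp => ?_
  obtain ⟨C⟩ := hp
  have hpos : 0 < p := (C (Classical.arbitrary V)).pos
  exact iInf₂_le p ⟨hpos, C, h.isBalancedColouring C⟩

end SignedGraph

/-! ### Alternating subsets with a prescribed first sign -/

/-- `A` is the alternating signed subset `{e a₁, -e a₂, …}` of `[n]` with `l` elements and first
sign `e`. -/
def IsAlternatingFrom (n l : ℕ) (e : ℤˣ) (A : Finset ℤ) : Prop :=
  ∃ a : Fin l → ℤ, StrictMono a ∧ (∀ j, 1 ≤ a j ∧ a j ≤ (n : ℤ)) ∧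
    A = Finset.univ.image (fun j : Fin l => (e : ℤ) * ((-1) ^ (j : ℕ) * a j))

theorem abs_alternating_term (e : ℤˣ) (j : ℕ) {x : ℤ} (hx : 1 ≤ x) :
    |(e : ℤ) * ((-1) ^ j * x)| = x := by
  rw [abs_mul, abs_mul, abs_pow, abs_neg, abs_one, one_pow, one_mul,
    Int.abs_eq_natAbs (e : ℤ), Int.units_natAbs, Nat.cast_one, one_mul, abs_of_nonneg (by omega)]

namespace IsAlternatingFrom

variable {n l : ℕ} {e : ℤˣ} {A B : Finset ℤ}

theorem neg (h : IsAlternatingFrom n l e A) : IsAlternatingFrom n l (-e) (-A) := by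
  obtain ⟨a, ha, hb, rfl⟩ := h
  refine ⟨a, ha, hb, ?_⟩
  ext x
  simp only [Finset.mem_neg', Finset.mem_image, Finset.mem_univ, true_and, Units.val_neg, neg_mul]
  exact exists_congr fun j => neg_eq_iff_eq_neg.symm.trans eq_comm |>.trans eq_comm

theorem isAlternating (h : IsAlternatingFrom n l 1 A) : IsAlternating n l A := by
  obtain ⟨a, ha, hb, rfl⟩ := h
  exact ⟨a, ha, hb, Or.inl (by simp)⟩

theorem isSignedSubset (h : IsAlternatingFrom n l e A) : IsSignedSubset n l A := by
  obtain ⟨a, ha, hb, rfl⟩ := h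
  have habs := fun j => abs_alternating_term e (j : Fin l) (hb j).1
  refine ⟨?_, ?_, ?_⟩
  · intro x hx
    obtain ⟨j, -, rfl⟩ := Finset.mem_image.mp hx
    have := hb j
    refine ⟨fun h0 => ?_, by rw [habs]; exact this.2⟩
    have h1 := habs j
    rw [h0, abs_zero] at h1
    omega
  · rw [Finset.card_image_of_injective, Finset.card_univ, Fintype.card_fin]
    intro i j hij
    apply ha.injective
    rw [← habs i, ← habs j]
    exact congrArg abs hij
  · intro i _
    rw [Finset.card_le_one]
    intro x hx y hy
    rw [Finset.mem_inter, Finset.mem_image] at hx hy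
    obtain ⟨⟨j, -, rfl⟩, hx⟩ := hx
    obtain ⟨⟨j', -, rfl⟩, hy⟩ := hy
    have h1 : ∀ z ∈ ({i, -i} : Finset ℤ), |z| = |i| := by
      intro z hz
      rw [Finset.mem_insert, Finset.mem_singleton] at hz
      rcases hz with rfl | rfl
      · rfl
      · exact abs_neg i
    have h2 := (h1 _ hx).trans (h1 _ hy).symm
    rw [habs, habs] at h2
    rw [ha.injective h2]

theorem firstPositive (h : IsAlternatingFrom n l 1 A) (hl : 1 ≤ l) : FirstPositive A := by
  obtain ⟨a, ha, hb, rfl⟩ := h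
  refine ⟨a ⟨0, hl⟩, Finset.mem_image.mpr ⟨⟨0, hl⟩, Finset.mem_univ _, by simp⟩,
    by have := hb ⟨0, hl⟩; omega, ?_⟩
  intro x hx
  obtain ⟨j, -, rfl⟩ := Finset.mem_image.mp hx
  rw [abs_alternating_term _ _ (hb j).1, abs_of_nonneg (by have := hb ⟨0, hl⟩; omega)]
  exact ha.monotone (Fin.mk_le_of_le_val (Nat.zero_le _))

theorem singleton {x : ℤ} (hx : x ≠ 0) (hxn : |x| ≤ n) : ∃ e, IsAlternatingFrom n 1 e {x} := by
  rcases lt_or_gt_of_ne hx with h | h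
  · refine ⟨-1, fun _ => -x, Subsingleton.strictMono _, fun _ => ?_, by simp⟩
    rw [abs_of_neg h] at hxn
    exact ⟨by simp only; omega, hxn⟩
  · refine ⟨1, fun _ => x, Subsingleton.strictMono _, fun _ => ?_, by simp⟩
    rw [abs_of_pos h] at hxn
    exact ⟨Int.add_one_le_of_lt (by simpa using h), hxn⟩

theorem exists_subset (hln : l ≤ n) : ∃ A, IsAlternatingFrom n l 1 A :=
  ⟨_, fun j => (j : ℤ) + 1, fun i j h => by simpa using h,
    fun j => ⟨by simp, by have := j.2; simp only; omega⟩, rfl⟩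

/-- Two alternating subsets of a signed set, with opposite first signs, yield a longer one. -/
theorem exists_succ {X : Finset ℤ} (hX : IsSignedSet n X) (hl : 1 ≤ l)
    (hA : IsAlternatingFrom n l e A) (hAX : A ⊆ X) (hB : IsAlternatingFrom n l (-e) B)
    (hBX : B ⊆ X) : ∃ C e', C ⊆ X ∧ IsAlternatingFrom n (l + 1) e' C := by
  have key : ∀ (e : ℤˣ) (a b : Fin l → ℤ), StrictMono b →
      (∀ j, 1 ≤ a j ∧ a j ≤ (n : ℤ)) → (∀ j, 1 ≤ b j ∧ b j ≤ (n : ℤ)) →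
      Finset.univ.image (fun j : Fin l => (e : ℤ) * ((-1) ^ (j : ℕ) * a j)) ⊆ X →
      Finset.univ.image (fun j : Fin l => ((-e : ℤˣ) : ℤ) * ((-1) ^ (j : ℕ) * b j)) ⊆ X →
      a ⟨0, hl⟩ < b ⟨0, hl⟩ → ∃ C e', C ⊆ X ∧ IsAlternatingFrom n (l + 1) e' C := by
    intro e a b hbm ha hb hAX hBX hlt
    -- Prepend the smaller first element to the other sequence, which starts with the opposite sign.
    refine ⟨_, e, ?_, Fin.cons (a ⟨0, hl⟩) b, ?_, ?_, rfl⟩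
    · intro x hx
      obtain ⟨j, -, rfl⟩ := Finset.mem_image.mp hx
      refine Fin.cases ?_ (fun i => ?_) j
      · exact hAX (Finset.mem_image.mpr ⟨⟨0, hl⟩, Finset.mem_univ _, by simp⟩)
      · refine hBX (Finset.mem_image.mpr ⟨i, Finset.mem_univ _, ?_⟩)
        simp [pow_succ]
    · intro i j
      refine Fin.cases ?_ (fun i => ?_) i <;> refine Fin.cases ?_ (fun j => ?_) j
      · simp
      · intro _
        simp only [Fin.cons_zero, Fin.cons_succ]
        exact hlt.trans_le (hbm.monotone (Fin.mk_le_of_le_val (Nat.zero_le _)))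
      · intro h
        exact absurd h (Fin.not_lt_zero _)
      · intro h
        simp only [Fin.cons_succ]
        exact hbm (Fin.succ_lt_succ_iff.mp h)
    · intro j
      refine Fin.cases ?_ (fun i => ?_) j
      · exact ha _
      · exact hb i
  obtain ⟨a, ham, ha, rfl⟩ := hA
  obtain ⟨b, hbm, hb, rfl⟩ := hB
  rcases lt_trichotomy (a ⟨0, hl⟩) (b ⟨0, hl⟩) with h | h | h
  · exact key e a b hbm ha hb hAX hBX h
  -- Equal first absolute values would put opposite elements into `X`.
  · exfalso
    have h1 : (e : ℤ) * a ⟨0, hl⟩ ∈ X :=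
      hAX (Finset.mem_image.mpr ⟨⟨0, hl⟩, Finset.mem_univ _, by simp⟩)
    have h2 : -((e : ℤ) * a ⟨0, hl⟩) ∈ X :=
      hBX (Finset.mem_image.mpr ⟨⟨0, hl⟩, Finset.mem_univ _, by simp [h]⟩)
    exact (hX _ h1).2.2 h2
  · exact key (-e) b a ham hb ha hBX (by rwa [neg_neg]) h

end IsAlternatingFrom

/-! ### The two bounds and the theorem -/

/-- The signed set `A` or `-A`, according to the sign `u`. -/
def signMul (u : ℤˣ) (A : Finset ℤ) : Finset ℤ :=
  A.image (fun x => (u : ℤ) * x)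

theorem mul_mem_signMul {u : ℤˣ} {A : Finset ℤ} {x : ℤ} (hx : x ∈ A) : (u : ℤ) * x ∈ signMul u A :=
  Finset.mem_image_of_mem _ hx

theorem one_signMul (A : Finset ℤ) : signMul 1 A = A := by
  simp [signMul]

theorem neg_signMul (u : ℤˣ) (A : Finset ℤ) : signMul (-u) A = -signMul u A := by
  ext x
  simp only [signMul, Finset.mem_neg', Finset.mem_image, Units.val_neg, neg_mul, neg_eq_iff_eq_neg]

theorem neg_one_signMul (A : Finset ℤ) : signMul (-1) A = -A := by
  rw [neg_signMul, one_signMul]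

theorem signMul_signMul (u v : ℤˣ) (A : Finset ℤ) : signMul u (signMul v A) = signMul (u * v) A := by
  simp [signMul, Finset.image_image, Function.comp_def, mul_assoc]

/-- The Schrijver-type lower bound: a signed graph realizing the Kneser adjacency on a family of
signed sets that contains all alternating `k`-sets with positive first element. -/
theorem le_of_isBalancedColouring {n k : ℕ} (hk : 1 ≤ k) (hkn : k ≤ n) {W : Type*}
    {G : SignedGraph W} {val : W → Finset ℤ}
    (hpos : ∀ u v, val u ∩ -val v = ∅ → G.Adj 1 u v)
    (hneg : ∀ u v, val u ∩ val v = ∅ → G.Adj (-1) u v)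
    (hval : ∀ A, IsAlternatingFrom n k 1 A → ∃ w, val w = A)
    {p : ℕ} {f : W → Fin p} (hf : G.IsBalancedColouring f) : n - k + 1 ≤ p := by
  obtain ⟨ε, hε⟩ := hf.exists_sign
  let Q : Finset ℤ → ℕ → ℤˣ → Prop := fun X l e =>
    (1 ≤ l ∧ l < k ∧ ∃ A ⊆ X, IsAlternatingFrom n l e A) ∨
      ∃ w, l = k + f w ∧ signMul (e * ε w) (val w) ⊆ X
  have hQ : ∀ X l e A, A ⊆ X → IsAlternatingFrom n l e A → 1 ≤ l → l ≤ k →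
      ∃ l' e', l ≤ l' ∧ Q X l' e' := by
    intro X l e A hAX hA hl hlk
    rcases hlk.lt_or_eq with h | rfl
    · exact ⟨l, e, le_rfl, Or.inl ⟨hl, h, A, hAX, hA⟩⟩
    · have hw : ∃ u : ℤˣ, ∃ w, signMul u (val w) = A := by
        rcases Int.units_eq_one_or e with rfl | rfl
        · obtain ⟨w, hw⟩ := hval A hA
          exact ⟨1, w, by rw [one_signMul, hw]⟩
        · obtain ⟨w, hw⟩ := hval (-A) (by simpa using hA.neg)
          exact ⟨-1, w, by rw [neg_one_signMul, hw, neg_neg]⟩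
      obtain ⟨u, w, rfl⟩ := hw
      -- The factor `ε w` is chosen to cancel the twist in `Q`.
      refine ⟨l + f w, u * ε w, by omega, Or.inr ⟨w, rfl, ?_⟩⟩
      rwa [mul_assoc, Int.units_mul_self, mul_one]
  obtain ⟨A₀, hA₀⟩ := IsAlternatingFrom.exists_subset hkn
  obtain ⟨w₀, -⟩ := hval A₀ hA₀
  have hp : 0 < p := (f w₀).pos
  -- Colours start at `0`, so `k + (p - 1)` bounds all labels.
  have hM : n ≤ k + (p - 1) := by
    refine octahedral_tucker (hk.trans hkn) Q ?_ ?_ ?_ ?_ ?_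
    · rintro X Y l e hXY (⟨h1, h2, A, hA, h3⟩ | ⟨w, h1, h2⟩)
      · exact Or.inl ⟨h1, h2, A, hA.trans hXY, h3⟩
      · exact Or.inr ⟨w, h1, h2.trans hXY⟩
    · rintro X l e (⟨h1, h2, A, hA, h3⟩ | ⟨w, h1, h2⟩)
      · exact Or.inl ⟨h1, h2, -A, Finset.neg_subset_neg hA, h3.neg⟩
      · refine Or.inr ⟨w, h1, ?_⟩
        rw [neg_mul, neg_signMul]
        exact Finset.neg_subset_neg h2
    · rintro X l e (⟨h1, h2, -⟩ | ⟨w, h1, -⟩)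
      · omega
      · have := (f w).2
        omega
    · rintro X hX ⟨x, hx⟩
      obtain ⟨e, he⟩ := IsAlternatingFrom.singleton (hX x hx).1 (hX x hx).2.1
      exact hQ X 1 e {x} (Finset.singleton_subset_iff.mpr hx) he le_rfl hk
    · rintro X l hX (⟨h1, h2, A, hA, h3⟩ | ⟨w, h1, h2⟩) (⟨h1', h2', B, hB, h3'⟩ | ⟨w', h1', h2'⟩)
      · obtain ⟨C, e', hC, h⟩ := IsAlternatingFrom.exists_succ hX h1 h3 hA h3' hB
        obtain ⟨l', e'', hl', h⟩ := hQ X (l + 1) e' C hC h (by omega) h2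
        exact ⟨l', e'', hl', h⟩
      · omega
      · omega
      · exfalso
        have hff : f w = f w' := Fin.ext (by omega)
        have hdisj : ∀ x, x ∈ signMul (ε w) (val w) → x ∈ signMul (ε w') (val w') → False := by
          intro x hx hx'
          rw [one_mul] at h2
          rw [neg_mul, one_mul, neg_signMul] at h2'
          exact (hX x (h2 hx)).2.2 (h2' (Finset.neg_mem_neg hx'))
        -- The twisted sets lie in `X` and `-X`, hence are disjoint. Untwisting, either product `ε w
        -- * ε w'` gives an edge of the opposite sign.
        have hinter : val w ∩ signMul (ε w * ε w') (val w') = ∅ := by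
          rw [Finset.eq_empty_iff_forall_notMem]
          intro x hx
          rw [Finset.mem_inter] at hx
          refine hdisj _ (mul_mem_signMul hx.1) ?_
          have := mul_mem_signMul (u := ε w) hx.2
          rwa [signMul_signMul, ← mul_assoc, Int.units_mul_self, one_mul] at this
        rcases Int.units_eq_one_or (ε w * ε w') with h | h
        · rw [h, one_signMul] at hinter
          exact absurd ((hε _ w w' hff (hneg _ _ hinter)).trans h) (by decide)
        · rw [h, neg_one_signMul] at hinter
          exact absurd ((hε _ w w' hff (hpos _ _ hinter)).trans h) (by decide)
  omega

/-- Colouring by the element of least absolute value. -/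
theorem colorable_negativeSubgraph {n k : ℕ} (hkn : k ≤ n) {W : Type*}
    {G : SignedGraph W} {val : W → Finset ℤ}
    (hadj : ∀ u v, G.Adj (-1) u v → val u ∩ val v = ∅)
    (hsub : ∀ w, IsSignedSubset n k (val w)) (hfirst : ∀ w, FirstPositive (val w)) :
    G.negativeSubgraph.Colorable (n - k + 1) := by
  choose a ha hapos hmin using hfirst
  have hbound : ∀ w, a w ≤ n - k + 1 := by
    intro w
    obtain ⟨h1, h2, h3⟩ := hsub w
    -- The `k` distinct absolute values must fit between the least one and `n`.
    have hmap : ((val w).image abs) ⊆ Finset.Icc (a w) n := by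
      intro x hx
      obtain ⟨y, hy, rfl⟩ := Finset.mem_image.mp hx
      have := hmin w y hy
      rw [abs_of_pos (hapos w)] at this
      exact Finset.mem_Icc.mpr ⟨this, (h1 y hy).2⟩
    have hinj : Set.InjOn (abs : ℤ → ℤ) (val w : Set ℤ) := by
      intro x hx y hy hxy
      have hmem := h3 |x| (Finset.mem_Icc.mpr ⟨Int.one_le_abs (h1 x hx).1, (h1 x hx).2⟩)
      rw [Finset.card_le_one] at hmem
      refine hmem x ?_ y ?_
      · rw [Finset.mem_inter, Finset.mem_insert, Finset.mem_singleton]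
        exact ⟨hx, eq_or_eq_neg_of_abs_eq rfl⟩
      · rw [Finset.mem_inter, Finset.mem_insert, Finset.mem_singleton]
        exact ⟨hy, eq_or_eq_neg_of_abs_eq hxy.symm⟩
    have hcard := Finset.card_le_card hmap
    rw [Finset.card_image_of_injOn hinj, h2, Int.card_Icc] at hcard
    have := (h1 _ (ha w)).2
    rw [abs_of_pos (hapos w)] at this
    omega
  refine ⟨SimpleGraph.Coloring.mk
    (fun w => ⟨(a w - 1).toNat, by have := hbound w; have := hapos w; omega⟩) ?_⟩
  intro u v huv he
  have h1 := hadj u v huv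
  have h2 := hapos u
  have h3 := hapos v
  have h4 : a u = a v := by
    have := Fin.val_eq_of_eq he
    simp only at this
    omega
  rw [Finset.eq_empty_iff_forall_notMem] at h1
  exact h1 (a u) (Finset.mem_inter.mpr ⟨ha u, h4 ▸ ha v⟩)

/-- Everything follows from `n - k + 1 ≤ χ_b ≤ χ(H⁻)` for each switching `H`, closed up at `H = G`
by the explicit colouring. -/
theorem chromatic_numbers_of_kneser_adjacency {n k : ℕ} (hk : 1 ≤ k) (hkn : k ≤ n) {W : Type*}
    {G : SignedGraph W} {val : W → Finset ℤ}
    (hadj : ∀ s u v, G.Adj s u v ↔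
      (s = 1 ∧ val u ∩ -val v = ∅) ∨ (s = -1 ∧ val u ∩ val v = ∅))
    (hsub : ∀ w, IsSignedSubset n k (val w)) (hfirst : ∀ w, FirstPositive (val w))
    (hval : ∀ A, IsAlternatingFrom n k 1 A → ∃ w, val w = A) :
    G.negativeSubgraph.chromaticNumber = ((n - k + 1 : ℕ) : ℕ∞) ∧
      G.balancedChromaticNumber = G.negativeSubgraph.chromaticNumber ∧
      IsLeast {c : ℕ∞ | ∃ H, G.SwitchingEquivalent H ∧ c = H.negativeSubgraph.chromaticNumber}
        G.negativeSubgraph.chromaticNumber := by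
  obtain ⟨A₀, hA₀⟩ := IsAlternatingFrom.exists_subset hkn
  obtain ⟨w₀, -⟩ := hval A₀ hA₀
  have : Nonempty W := ⟨w₀⟩
  have hlower : ((n - k + 1 : ℕ) : ℕ∞) ≤ G.balancedChromaticNumber := by
    refine le_iInf₂ fun p hp => ?_
    obtain ⟨-, f, hf⟩ := hp
    exact_mod_cast le_of_isBalancedColouring hk hkn
      (fun u v h => (hadj 1 u v).mpr (Or.inl ⟨rfl, h⟩))
      (fun u v h => (hadj (-1) u v).mpr (Or.inr ⟨rfl, h⟩)) hval hf
  have hupper : G.negativeSubgraph.chromaticNumber ≤ ((n - k + 1 : ℕ) : ℕ∞) := by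
    refine (colorable_negativeSubgraph hkn (fun u v h => ?_) hsub hfirst).chromaticNumber_le
    rcases (hadj (-1) u v).mp h with ⟨h, -⟩ | ⟨-, h⟩
    · exact absurd h (by decide)
    · exact h
  have hle : ∀ H, G.SwitchingEquivalent H →
      G.balancedChromaticNumber ≤ H.negativeSubgraph.chromaticNumber :=
    fun H h => SignedGraph.balancedChromaticNumber_le_of_switchingEquivalent h
  have hrefl : G.SwitchingEquivalent G := Relation.ReflTransGen.refl
  refine ⟨le_antisymm hupper (hlower.trans (hle G hrefl)),
    le_antisymm (hle G hrefl) (hupper.trans hlower), ⟨G, hrefl, rfl⟩, ?_⟩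
  rintro c ⟨H, hH, rfl⟩
  exact hupper.trans (hlower.trans (hle H hH))

theorem theorem13 (n k : ℕ) (hk : 1 ≤ k) (hkn : k ≤ n) :
    (kneserSignedGraphHat n k hk).negativeSubgraph.chromaticNumber = ((n - k + 1 : ℕ) : ℕ∞) ∧
    (schrijverSignedGraphHat n k hk).negativeSubgraph.chromaticNumber = ((n - k + 1 : ℕ) : ℕ∞) ∧
    ((kneserSignedGraphHat n k hk).balancedChromaticNumber =
        (kneserSignedGraphHat n k hk).negativeSubgraph.chromaticNumber ∧
      IsLeast {c : ℕ∞ | ∃ H, (kneserSignedGraphHat n k hk).SwitchingEquivalent H ∧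
          c = H.negativeSubgraph.chromaticNumber}
        (kneserSignedGraphHat n k hk).negativeSubgraph.chromaticNumber) ∧
    ((schrijverSignedGraphHat n k hk).balancedChromaticNumber =
        (schrijverSignedGraphHat n k hk).negativeSubgraph.chromaticNumber ∧
      IsLeast {c : ℕ∞ | ∃ H, (schrijverSignedGraphHat n k hk).SwitchingEquivalent H ∧
          c = H.negativeSubgraph.chromaticNumber}
        (schrijverSignedGraphHat n k hk).negativeSubgraph.chromaticNumber) := by
  obtain ⟨hK, hK'⟩ := chromatic_numbers_of_kneser_adjacency hk hkn
    (G := kneserSignedGraphHat n k hk) (val := fun w => w.1.1) (fun _ _ _ => Iff.rfl)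
    (fun w => w.1.2) (fun w => w.2)
    (fun A hA => ⟨⟨⟨A, hA.isSignedSubset⟩, hA.firstPositive hk⟩, rfl⟩)
  obtain ⟨hS, hS'⟩ := chromatic_numbers_of_kneser_adjacency hk hkn
    (G := schrijverSignedGraphHat n k hk) (val := fun w => w.1.1.1) (fun _ _ _ => Iff.rfl)
    (fun w => w.1.1.2) (fun w => w.2)
    (fun A hA => ⟨⟨⟨⟨A, hA.isSignedSubset⟩, hA.isAlternating⟩, hA.firstPositive hk⟩, rfl⟩)
  exact ⟨hK, hS, hK', hS'⟩
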